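/- Let $\mathrm{Int}(\mathbb{Z})=\{g\in\mathbb{Q}[x] : g(\mathbb{Z})\subseteq\mathbb{Z}\}$. A factorization of $r\in \mathrm{Int}(\mathbb{Z})$ is an expression $r=s_1\cdots s_k$ of $r$ as a product of irreducible elements of $\mathrm{Int}(\mathbb{Z})$; $k$ is its length. Two factorizations $r=r_1\cdots r_k=s_1\cdots s_l$ are essentially the same if $k=l$ and, after re-indexing the $s_j$, each $r_j$ equals $s_j$ times a unit of $\mathrm{Int}(\mathbb{Z})$; otherwise they are essentially different. Theorem 9. For all natural numbers $1\le m_1\le\dots\le m_n$ there exists a polynomial $H\in\mathrm{Int}(\mathbb{Z})$ that has exactly $n$ essentially different factorizations into irreducibles in $\mathrm{Int}(\mathbb{Z})$, the lengths of these factorizations being $m_1+1,\dots,m_n+1$ (counted with multiplicity). -/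

import Mathlib

open Polynomial

/-- The ring `Int(ℤ) = {g ∈ ℚ[x] : g(ℤ) ⊆ ℤ}` of integer-valued polynomials, as a subring of
`ℚ[x]`. -/
def IntValuedPoly : Subring ℚ[X] where
  carrier := {g | ∀ z : ℤ, ∃ w : ℤ, g.eval (z : ℚ) = (w : ℚ)}
  zero_mem' := fun _ => ⟨0, by simp⟩
  one_mem' := fun _ => ⟨1, by simp⟩
  add_mem' := by
    intro f g hf hg z
    obtain ⟨a, ha⟩ := hf z
    obtain ⟨b, hb⟩ := hg z
    exact ⟨a + b, by simp [ha, hb]⟩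
  mul_mem' := by
    intro f g hf hg z
    obtain ⟨a, ha⟩ := hf z
    obtain ⟨b, hb⟩ := hg z
    exact ⟨a * b, by simp [ha, hb]⟩
  neg_mem' := by
    intro f hf z
    obtain ⟨a, ha⟩ := hf z
    exact ⟨-a, by simp [ha]⟩

/-- `s` is a factorization of `r`: a finite (unordered) family of irreducible elements of `R`,
with repetitions, whose product is exactly `r`. Its length is `Multiset.card s`. -/
def IsFactorization {R : Type*} [CommRing R] (r : R) (s : Multiset R) : Prop :=
  (∀ a ∈ s, Irreducible a) ∧ s.prod = r

/-- Two factorizations are essentially the same if their factors can be matched bijectively so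
that matched factors are associated (in `R`); in particular their lengths agree. -/
def EssentiallySame {R : Type*} [CommRing R] (s t : Multiset R) : Prop :=
  Multiset.Rel Associated s t

/-!
The polynomial is `H = p⁻¹ ∏ F i`, where the `F i` are distinct monic irreducible polynomials in
`ℤ[X]` indexed by a finite type, `p` is a prime, and the product of the `F i` has fixed divisor
exactly `p`: at every integer `p` divides some `F i`, but `p²` does not divide all values
of the product, and neither does any prime other than `p`. Call a set `T` of indices covering if at every integer `p` divides some
`F i` with `i ∈ T`; equivalently, `p⁻¹ ∏_{i ∈ T} F i` is integer-valued.

Unique factorization over `ℚ` determines a divisor of `H`, up to a rational constant, by a set of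
indices. The constant is then determined up to sign, because a divisor of `H` has fixed divisor `1`
like `H` itself, and two polynomials with fixed divisor `1` that agree up to a constant agree up to
sign (`IntValuedPoly.ValuePrimitive.associated`). Some integer is covered by a single index `i₀`,
so exactly one factor in a factorization of `H` contains `F i₀` and carries the denominator `p`. The
others are products of `F i`, hence single `F i` by irreducibility. Irreducibility of the factor
with the denominator says that its set of indices is a minimal covering set. So the factorizations
of `H` correspond to the minimal covering sets `T`, the length being one more than the number of
indices outside `T` (`PrimeCoveringFamily.isFactorization`,
`PrimeCoveringFamily.exists_essentiallySame`).

Every cover of `ZMod p` by nonempty sets `S i`, with a residue that lies in only one of them, is the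
covering pattern of such a family (`exists_primeCoveringFamily`). The polynomial `F i` is a product
of linear factors with roots `e r`, `r ∈ S i`, plus a constant divisible by `p²`, the integer `e`
being `1` modulo `p` and highly divisible by the other small primes. The constant makes `F i` an
Eisenstein polynomial at `2`, and modulo any other small prime `F i` is a power of `X`.

It remains to choose a cover. The indices are `none` and pairs `(k, j)` with `j < m k`, in `n` classes
according to `k`. Each pair of indices from different classes shares a residue that no other index
has, and `none` has a residue of its own. A covering set thus contains `none` and misses indices
from at most one class, so the minimal ones are the complements of the `n` classes
(`minimal_cover_iff`).
-/

open Polynomial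

/-! ### Fixed divisors of integer-valued polynomials -/

namespace IntValuedPoly

theorem ext_val {f g : IntValuedPoly} (h : (f : ℚ[X]) = g) : f = g := Subtype.ext h

/-- The value of an integer-valued polynomial at an integer, as an element of `ℤ`. -/
noncomputable def intValue (f : IntValuedPoly) (z : ℤ) : ℤ := (f.2 z).choose

theorem eval_eq_intValue (f : IntValuedPoly) (z : ℤ) :
    (f : ℚ[X]).eval (z : ℚ) = (intValue f z : ℚ) :=
  (f.2 z).choose_spec

theorem intValue_eq {f : IntValuedPoly} {z w : ℤ} (h : (f : ℚ[X]).eval (z : ℚ) = w) :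
    intValue f z = w := by
  rw [eval_eq_intValue] at h
  exact_mod_cast h

/-- Evaluation of integer-valued polynomials at an integer, as a ring homomorphism to `ℤ`. -/
noncomputable def evalInt (z : ℤ) : IntValuedPoly →+* ℤ where
  toFun f := intValue f z
  map_one' := intValue_eq (by simp)
  map_zero' := intValue_eq (by simp)
  map_mul' f g := intValue_eq (by simp [eval_eq_intValue])
  map_add' f g := intValue_eq (by simp [eval_eq_intValue])

theorem eval_eq_evalInt (f : IntValuedPoly) (z : ℤ) :
    (f : ℚ[X]).eval (z : ℚ) = (evalInt z f : ℚ) :=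
  eval_eq_intValue f z

/-- The inclusion of `ℤ[X]` into the ring of integer-valued polynomials. -/
noncomputable def ofIntPoly : ℤ[X] →+* IntValuedPoly :=
  (mapRingHom (Int.castRingHom ℚ)).codRestrict IntValuedPoly fun f z =>
    ⟨f.eval z, by simp [eval_intCast_map]⟩

@[simp] theorem coe_ofIntPoly (f : ℤ[X]) :
    (ofIntPoly f : ℚ[X]) = f.map (Int.castRingHom ℚ) := rfl

@[simp] theorem evalInt_ofIntPoly (f : ℤ[X]) (z : ℤ) : evalInt z (ofIntPoly f) = f.eval z := by
  have h := eval_eq_evalInt (ofIntPoly f) z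
  rw [coe_ofIntPoly, eval_intCast_map] at h
  simp at h
  exact_mod_cast h.symm

/-- An integer-valued polynomial is value-primitive if no prime divides all of its values on
`ℤ`, that is, if its fixed divisor is `1`. -/
def ValuePrimitive (f : IntValuedPoly) : Prop :=
  ∀ q : ℕ, q.Prime → ∃ z : ℤ, ¬ (q : ℤ) ∣ evalInt z f

theorem ValuePrimitive.of_dvd {f g : IntValuedPoly} (hg : ValuePrimitive g) (h : f ∣ g) :
    ValuePrimitive f := fun q hq =>
  (hg q hq).imp fun z hz hf => hz (hf.trans (map_dvd (evalInt z) h))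

/-- If `v f = u g` with `u`, `v` coprime integers and `g` is value-primitive, then `v` is a
unit. -/
theorem ValuePrimitive.isUnit_of_mul_eq {f g : IntValuedPoly} (hg : ValuePrimitive g) {u v : ℤ}
    (huv : IsCoprime u v) (h : (v : IntValuedPoly) * f = u * g) : IsUnit v := by
  by_contra hv
  rw [Int.isUnit_iff_natAbs_eq] at hv
  obtain ⟨q, hq, hqv⟩ := Nat.exists_prime_and_dvd hv
  have hqv' : (q : ℤ) ∣ v := Int.natCast_dvd.2 hqv
  obtain ⟨z, hz⟩ := hg q hq
  have h2 := congrArg (evalInt z) h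
  simp only [map_mul, map_intCast, Int.cast_id] at h2
  have hd : (q : ℤ) ∣ u * evalInt z g := h2 ▸ hqv'.mul_right _
  rcases (Nat.prime_iff_prime_int.1 hq).dvd_or_dvd hd with h3 | h3
  · exact (Nat.prime_iff_prime_int.1 hq).not_isUnit (huv.isUnit_of_dvd' h3 hqv')
  · exact hz h3

/-- Value-primitive polynomials that differ by a rational constant differ by a sign. -/
theorem ValuePrimitive.associated {f g : IntValuedPoly} (hf : ValuePrimitive f)
    (hg : ValuePrimitive g) (h : Associated (f : ℚ[X]) g) : Associated f g := by
  obtain ⟨w, hw⟩ := h.symm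
  obtain ⟨c, hc0, hc⟩ := Polynomial.isUnit_iff.1 w.isUnit
  rw [← hc] at hw
  have hcop : IsCoprime c.num (c.den : ℤ) := by
    rw [Int.isCoprime_iff_gcd_eq_one]; exact c.reduced
  have hden : (c.den : ℚ) ≠ 0 := by exact_mod_cast c.den_nz
  have key : (((c.den : ℤ) : IntValuedPoly)) * f = (c.num : IntValuedPoly) * g := by
    apply ext_val
    change (((c.den : ℤ) : ℚ[X])) * (f : ℚ[X]) = ((c.num : ℤ) : ℚ[X]) * (g : ℚ[X])
    rw [← hw]
    have : ((c.num : ℤ) : ℚ[X]) = ((c.den : ℤ) : ℚ[X]) * C c := by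
      rw [← C_eq_intCast, ← C_eq_intCast, ← C_mul]
      congr 1
      have := c.mul_den_eq_num
      push_cast
      rw [mul_comm]; exact this.symm
    rw [this]; ring
  have hv := hg.isUnit_of_mul_eq hcop key
  have hu := hf.isUnit_of_mul_eq hcop.symm key.symm
  have h1 : Associated (((c.den : ℤ) : IntValuedPoly) * f) f :=
    associated_unit_mul_left f _ (hv.map (Int.castRingHom IntValuedPoly))
  have h2 : Associated ((c.num : IntValuedPoly) * g) g :=
    associated_unit_mul_left g _ (hu.map (Int.castRingHom IntValuedPoly))
  exact h1.symm.trans (key ▸ h2)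

theorem ValuePrimitive.isUnit {f : IntValuedPoly} (hf : ValuePrimitive f)
    (h : IsUnit (f : ℚ[X])) : IsUnit f :=
  (hf.associated (hf.of_dvd (one_dvd f)) (associated_one_iff_isUnit.2 h)).symm.isUnit isUnit_one

theorem natCast_dvd_iff {k : ℕ} (hk : k ≠ 0) {f : IntValuedPoly} :
    (k : IntValuedPoly) ∣ f ↔ ∀ z : ℤ, (k : ℤ) ∣ evalInt z f := by
  constructor
  · intro h z
    simpa using map_dvd (evalInt z) h
  · intro h
    have hk' : (k : ℚ) ≠ 0 := by exact_mod_cast hk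
    refine ⟨⟨C ((k : ℚ)⁻¹) * f, fun z => ?_⟩, ?_⟩
    · obtain ⟨w, hw⟩ := h z
      refine ⟨w, ?_⟩
      rw [eval_mul, eval_C, eval_eq_evalInt, hw]
      push_cast
      field_simp
    · apply ext_val
      change (f : ℚ[X]) = (k : ℚ[X]) * (C ((k : ℚ)⁻¹) * f)
      rw [← mul_assoc, ← C_eq_natCast, ← C_mul, mul_inv_cancel₀ hk', C_1, one_mul]

end IntValuedPoly

/-! ### Divisors of products of primes, and associated multisets -/

theorem exists_subset_associated_prod_of_dvd {I M : Type*} [DecidableEq I] [CommMonoidWithZero M]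
    [IsCancelMulZero M] {P : I → M} (hP : ∀ i, Prime (P i)) (T : Finset I) :
    ∀ {a : M}, a ∣ ∏ i ∈ T, P i → ∃ V ⊆ T, Associated a (∏ i ∈ V, P i) := by
  induction T using Finset.induction_on with
  | empty =>
    intro a ha
    exact ⟨∅, le_rfl, by simpa [associated_one_iff_isUnit, isUnit_iff_dvd_one] using ha⟩
  | insert i T hi ih =>
    intro a ha
    rw [Finset.prod_insert hi] at ha
    by_cases hia : P i ∣ a
    · obtain ⟨b, rfl⟩ := hia
      obtain ⟨V, hV, hb⟩ := ih ((mul_dvd_mul_iff_left (hP i).ne_zero).1 ha)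
      refine ⟨insert i V, Finset.insert_subset_insert i hV, ?_⟩
      rw [Finset.prod_insert fun h => hi (hV h)]
      exact hb.mul_left (P i)
    · obtain ⟨c, hc⟩ := ha
      rcases (hP i).dvd_or_dvd (Dvd.intro _ hc) with h | ⟨d, rfl⟩
      · exact absurd h hia
      · rw [mul_left_comm] at hc
        obtain ⟨V, hV, hb⟩ := ih (Dvd.intro d (mul_left_cancel₀ (hP i).ne_zero hc).symm)
        exact ⟨V, hV.trans (Finset.subset_insert i T), hb⟩

theorem Multiset.exists_rel_associated_map {I M : Type*} [Monoid M] (f : I → M)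
    (t : Multiset M) : (∀ b ∈ t, ∃ i, Associated b (f i)) →
      ∃ s : Multiset I, Multiset.Rel Associated t (s.map f) := by
  induction t using Multiset.induction_on with
  | empty => exact fun _ => ⟨0, by simp⟩
  | cons b t ih =>
    intro h
    obtain ⟨i, hi⟩ := h b (Multiset.mem_cons_self b t)
    obtain ⟨s, hs⟩ := ih fun c hc => h c (Multiset.mem_cons_of_mem hc)
    exact ⟨i ::ₘ s, by simpa using Multiset.Rel.cons hi hs⟩

theorem Multiset.Rel.associated_prod {M : Type*} [CommMonoid M] {s t : Multiset M}
    (h : Multiset.Rel Associated s t) : Associated s.prod t.prod := by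
  induction h with
  | zero => exact Associated.refl _
  | cons hab _ ih => simpa using hab.mul_mul ih

/-! ### Families of irreducible polynomials covering the integers modulo a prime -/

/-- A family, meant for a finite index type, of pairwise distinct monic polynomials `F i ∈ ℤ[X]`,
irreducible over `ℚ`, whose product has fixed divisor exactly the prime `p`. One index
`i₀` is distinguished: at the argument `z₀` the prime `p` divides only `F i₀`, and only to the first power. -/
structure PrimeCoveringFamily (p : ℕ) (I : Type*) where
  F : I → ℤ[X]
  prime : p.Prime
  monic : ∀ i, (F i).Monic
  irreducible : ∀ i, Irreducible ((F i).map (Int.castRingHom ℚ))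
  injective : Function.Injective F
  exists_dvd : ∀ z : ℤ, ∃ i, (p : ℤ) ∣ (F i).eval z
  i₀ : I
  z₀ : ℤ
  not_sq_dvd : ¬ (p : ℤ) ^ 2 ∣ (F i₀).eval z₀
  not_dvd : ∀ i, i ≠ i₀ → ¬ (p : ℤ) ∣ (F i).eval z₀
  exists_not_dvd : ∀ q : ℕ, q.Prime → q ≠ p → ∃ z : ℤ, ∀ i, ¬ (q : ℤ) ∣ (F i).eval z

namespace PrimeCoveringFamily

open IntValuedPoly

variable {p : ℕ} {I : Type*} (D : PrimeCoveringFamily p I)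

/-- `T` covers if at every integer `p` divides some `F i` with `i ∈ T`. -/
def Covers (T : Finset I) : Prop := ∀ z : ℤ, ∃ i ∈ T, (p : ℤ) ∣ (D.F i).eval z

/-- `F i` over the rationals. -/
noncomputable def ratPoly (i : I) : ℚ[X] := (D.F i).map (Int.castRingHom ℚ)

/-- `F i` as an integer-valued polynomial. -/
noncomputable def poly (i : I) : IntValuedPoly := ofIntPoly (D.F i)

/-- The product of the `F i` with `i ∈ T`. -/
noncomputable def prod (T : Finset I) : IntValuedPoly := ∏ i ∈ T, D.poly i

theorem coe_poly (i : I) : (D.poly i : ℚ[X]) = D.ratPoly i := rfl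

theorem coe_prod (T : Finset I) : (D.prod T : ℚ[X]) = ∏ i ∈ T, D.ratPoly i :=
  map_prod IntValuedPoly.subtype _ _

theorem prime_ratPoly (i : I) : Prime (D.ratPoly i) := (D.irreducible i).prime

theorem evalInt_prod (T : Finset I) (z : ℤ) :
    evalInt z (D.prod T) = ∏ i ∈ T, (D.F i).eval z := by
  simp [prod, poly]

theorem prod_ne_zero (T : Finset I) : D.prod T ≠ 0 := by
  intro h
  have h1 := congrArg (Subtype.val) h
  rw [coe_prod] at h1
  exact Finset.prod_ne_zero_iff.2 (fun i _ => (D.prime_ratPoly i).ne_zero) h1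

theorem natCast_ne_zero (D : PrimeCoveringFamily p I) : (p : IntValuedPoly) ≠ 0 := by
  exact_mod_cast D.prime.ne_zero

theorem isUnit_coe_natCast (D : PrimeCoveringFamily p I) : IsUnit (((p : IntValuedPoly)) : ℚ[X]) := by
  change IsUnit ((p : ℚ[X]))
  rw [← C_eq_natCast]
  exact Polynomial.isUnit_C.2 (by simpa using D.prime.ne_zero)

theorem ratPoly_injective : Function.Injective D.ratPoly := fun _ _ h =>
  D.injective (map_injective _ (Int.cast_injective) h)

theorem ratPoly_dvd_iff {i j : I} : D.ratPoly i ∣ D.ratPoly j ↔ i = j := by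
  refine ⟨fun h => D.ratPoly_injective ?_, fun h => h ▸ dvd_rfl⟩
  exact eq_of_monic_of_associated ((D.monic i).map _) ((D.monic j).map _)
    ((D.irreducible i).associated_of_dvd (D.irreducible j) h)

theorem ratPoly_dvd_prod_iff {i : I} {T : Finset I} :
    D.ratPoly i ∣ (D.prod T : ℚ[X]) ↔ i ∈ T := by
  rw [coe_prod, (D.prime_ratPoly i).dvd_finsetProd_iff]
  simp [ratPoly_dvd_iff]

/-- The product of the `F i` is squarefree over `ℚ`. -/
theorem not_mul_dvd_prod [DecidableEq I] {i : I} {a b : ℚ[X]} {T : Finset I}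
    (ha : D.ratPoly i ∣ a) (hb : D.ratPoly i ∣ b) : ¬ a * b ∣ (D.prod T : ℚ[X]) := by
  intro h
  have h2 := (mul_dvd_mul ha hb).trans h
  have hi : i ∈ T := D.ratPoly_dvd_prod_iff.1 ((dvd_mul_right _ _).trans h2)
  rw [coe_prod, ← Finset.mul_prod_erase T _ hi,
    mul_dvd_mul_iff_left (D.prime_ratPoly i).ne_zero, ← coe_prod, ratPoly_dvd_prod_iff] at h2
  simp at h2

theorem prod_mul_prod_sdiff [DecidableEq I] {U T : Finset I} (h : U ⊆ T) :
    D.prod U * D.prod (T \ U) = D.prod T := by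
  rw [mul_comm]; exact Finset.prod_sdiff h

theorem covers_iff_dvd {T : Finset I} : D.Covers T ↔ (p : IntValuedPoly) ∣ D.prod T := by
  rw [natCast_dvd_iff D.prime.ne_zero]
  refine forall_congr' fun z => ?_
  rw [evalInt_prod, (Nat.prime_iff_prime_int.1 D.prime).dvd_finsetProd_iff]

theorem i₀_mem {T : Finset I} (hT : D.Covers T) : D.i₀ ∈ T := by
  obtain ⟨i, hi, hd⟩ := hT D.z₀
  by_contra h
  exact D.not_dvd i (fun e => h (e ▸ hi)) hd

open Classical in
/-- The quotient `p⁻¹ ∏_{i ∈ T} F i`, for a covering set `T`; the value `1` for other `T` is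
irrelevant. -/
noncomputable def quot (T : Finset I) : IntValuedPoly :=
  if h : (p : IntValuedPoly) ∣ D.prod T then h.choose else 1

theorem natCast_mul_quot {T : Finset I} (hT : D.Covers T) : p * D.quot T = D.prod T := by
  have h := D.covers_iff_dvd.1 hT
  rw [quot, dif_pos h]
  exact h.choose_spec.symm

theorem quot_mul_prod_sdiff [DecidableEq I] {U T : Finset I} (h : U ⊆ T) (hU : D.Covers U)
    (hT : D.Covers T) : D.quot U * D.prod (T \ U) = D.quot T := by
  apply mul_left_cancel₀ D.natCast_ne_zero
  rw [← mul_assoc, natCast_mul_quot D hU, natCast_mul_quot D hT, prod_mul_prod_sdiff D h]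

theorem associated_coe_quot {T : Finset I} (hT : D.Covers T) :
    Associated (D.quot T : ℚ[X]) (D.prod T) := by
  rw [← D.natCast_mul_quot hT]
  exact associated_unit_mul_right _ _ D.isUnit_coe_natCast

theorem ratPoly_dvd_quot_iff {i : I} {T : Finset I} (hT : D.Covers T) :
    D.ratPoly i ∣ (D.quot T : ℚ[X]) ↔ i ∈ T := by
  rw [(D.associated_coe_quot hT).dvd_iff_dvd_right, ratPoly_dvd_prod_iff]

theorem not_isUnit_quot {T : Finset I} (hT : D.Covers T) : ¬ IsUnit (D.quot T) := fun h =>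
  (D.prime_ratPoly D.i₀).not_isUnit (isUnit_of_dvd_unit
    ((D.ratPoly_dvd_quot_iff hT).2 (D.i₀_mem hT)) (h.map IntValuedPoly.subtype))

theorem eq_empty_of_isUnit_prod {T : Finset I} (h : IsUnit (D.prod T)) : T = ∅ := by
  by_contra hT
  obtain ⟨i, hi⟩ := Finset.nonempty_iff_ne_empty.2 hT
  exact (D.prime_ratPoly i).not_isUnit (isUnit_of_dvd_unit
    (D.ratPoly_dvd_prod_iff.2 hi) (h.map IntValuedPoly.subtype))

theorem valuePrimitive_prod {T : Finset I} (hT : ¬ D.Covers T) : ValuePrimitive (D.prod T) := by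
  intro q hq
  by_cases hqp : q = p
  · subst hqp
    rw [covers_iff_dvd, natCast_dvd_iff hq.ne_zero] at hT
    exact not_forall.1 hT
  · obtain ⟨z, hz⟩ := D.exists_not_dvd q hq hqp
    refine ⟨z, ?_⟩
    rw [evalInt_prod, (Nat.prime_iff_prime_int.1 hq).dvd_finsetProd_iff]
    rintro ⟨i, -, hi⟩
    exact hz i hi

/-- At `z₀` the numerator has `p`-adic valuation `1`, which the denominator cancels. -/
theorem valuePrimitive_quot {T : Finset I} (hT : D.Covers T) : ValuePrimitive (D.quot T) := by
  classical
  have hval : ∀ z, p * evalInt z (D.quot T) = ∏ i ∈ T, (D.F i).eval z := fun z => by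
    rw [← evalInt_prod, ← D.natCast_mul_quot hT, map_mul, map_natCast]
  intro q hq
  by_cases hqp : q = p
  · subst hqp
    refine ⟨D.z₀, fun h => ?_⟩
    have hp := Nat.prime_iff_prime_int.1 hq
    have h2 := mul_dvd_mul_left (q : ℤ) h
    rw [hval, ← Finset.mul_prod_erase T _ (D.i₀_mem hT), ← sq] at h2
    refine D.not_sq_dvd (hp.pow_dvd_of_dvd_mul_right 2 ?_ h2)
    rw [hp.dvd_finsetProd_iff]
    rintro ⟨i, hi, hd⟩
    exact D.not_dvd i (Finset.ne_of_mem_erase hi) hd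
  · obtain ⟨z, hz⟩ := D.exists_not_dvd q hq hqp
    refine ⟨z, fun h => ?_⟩
    have h2 := h.mul_left (p : ℤ)
    rw [hval, (Nat.prime_iff_prime_int.1 hq).dvd_finsetProd_iff] at h2
    obtain ⟨i, -, hi⟩ := h2
    exact hz i hi

/-- A divisor of `p⁻¹ ∏_{i ∈ T} F i` which is not divisible by `F i₀` is a product of some of the
`F i`, up to sign. -/
theorem exists_associated_prod [DecidableEq I] {T : Finset I} (hT : D.Covers T)
    {b : IntValuedPoly} (hb : b ∣ D.quot T) (h₀ : ¬ D.ratPoly D.i₀ ∣ (b : ℚ[X])) :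
    ∃ V ⊆ T, Associated b (D.prod V) := by
  have h1 : (b : ℚ[X]) ∣ ∏ i ∈ T, D.ratPoly i := by
    rw [← coe_prod]
    exact (map_dvd IntValuedPoly.subtype hb).trans (D.associated_coe_quot hT).dvd
  obtain ⟨V, hV, hbV⟩ := exists_subset_associated_prod_of_dvd D.prime_ratPoly T h1
  rw [← coe_prod] at hbV
  have hV₀ : ¬ D.Covers V := fun h =>
    h₀ ((D.ratPoly_dvd_prod_iff.2 (D.i₀_mem h)).trans hbV.symm.dvd)
  exact ⟨V, hV, ((D.valuePrimitive_quot hT).of_dvd hb).associated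
    (D.valuePrimitive_prod hV₀) hbV⟩

/-- If the `F i` with `i ∈ V` split off from `p⁻¹ ∏_{i ∈ T} F i` inside the ring of integer-valued
polynomials, then `p` stays under the remaining factors, so that these still cover. -/
theorem associated_quot_sdiff [DecidableEq I] {T V : Finset I} (hT : D.Covers T)
    {a : IntValuedPoly} (h : Associated (a * D.prod V) (D.quot T)) :
    V ⊆ T ∧ D.Covers (T \ V) ∧ Associated a (D.quot (T \ V)) := by
  have hVT : V ⊆ T := fun i hi => (D.ratPoly_dvd_quot_iff hT).1
    ((D.ratPoly_dvd_prod_iff.2 hi).trans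
      (map_dvd IntValuedPoly.subtype ((dvd_mul_left _ a).trans h.dvd)))
  have h1 : Associated (p * a) (D.prod (T \ V)) := by
    refine Associated.of_mul_right ?_ (Associated.refl (D.prod V)) (D.prod_ne_zero V)
    rw [mul_comm (D.prod (T \ V)), D.prod_mul_prod_sdiff hVT, ← D.natCast_mul_quot hT, mul_assoc]
    exact h.mul_left _
  have hc : D.Covers (T \ V) := D.covers_iff_dvd.2 ((dvd_mul_right _ a).trans h1.dvd)
  rw [← D.natCast_mul_quot hc] at h1
  exact ⟨hVT, hc, h1.of_mul_left (Associated.refl _) D.natCast_ne_zero⟩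

/-! ### Factorizations and minimal covering sets -/

theorem irreducible_poly {i : I} (hi : i ≠ D.i₀) : Irreducible (D.poly i) := by
  have hvp : ValuePrimitive (D.poly i) := by
    have h : ¬ D.Covers {i} := fun h => hi (Finset.mem_singleton.1 (D.i₀_mem h)).symm
    simpa [prod] using D.valuePrimitive_prod h
  constructor
  · exact fun h => (D.irreducible i).not_isUnit (h.map IntValuedPoly.subtype)
  · intro a b hab
    have h : D.ratPoly i = (a : ℚ[X]) * b := congrArg Subtype.val hab
    refine ((D.irreducible i).isUnit_or_isUnit h).imp (fun h => ?_) fun h => ?_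
    · exact (hvp.of_dvd (Dvd.intro _ hab.symm)).isUnit h
    · exact (hvp.of_dvd (Dvd.intro_left _ hab.symm)).isUnit h

/-- A cofactor prime to `F i₀` is a product of some `F i`, and dividing these out leaves a smaller
covering set; minimality forces the product to be empty. -/
theorem isUnit_of_minimal [DecidableEq I] {T : Finset I} (hT : Minimal D.Covers T)
    {a b : IntValuedPoly} (hab : D.quot T = a * b) (h₀ : ¬ D.ratPoly D.i₀ ∣ (b : ℚ[X])) :
    IsUnit b := by
  obtain ⟨V, -, hbV⟩ := D.exists_associated_prod hT.prop (Dvd.intro_left _ hab.symm) h₀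
  obtain ⟨hVT, hc, -⟩ := D.associated_quot_sdiff hT.prop (a := a) (V := V)
    (by rw [hab]; exact hbV.symm.mul_left a)
  have hV : V = ∅ := by
    have h1 := hT.le_of_le hc Finset.sdiff_subset
    refine Finset.eq_empty_of_forall_notMem fun i hi => ?_
    exact (Finset.mem_sdiff.1 (h1 (hVT hi))).2 hi
  subst hV
  exact hbV.symm.isUnit (by simp [prod])

theorem irreducible_quot {T : Finset I} (hT : Minimal D.Covers T) : Irreducible (D.quot T) := by
  classical
  refine ⟨D.not_isUnit_quot hT.prop, fun a b hab => ?_⟩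
  by_cases hb : D.ratPoly D.i₀ ∣ (b : ℚ[X])
  · left
    refine D.isUnit_of_minimal hT (hab.trans (mul_comm a b)) fun ha => ?_
    refine D.not_mul_dvd_prod (T := T) ha hb ?_
    have : (a : ℚ[X]) * b = D.quot T := (congrArg Subtype.val hab).symm
    rw [this]
    exact (D.associated_coe_quot hT.prop).dvd
  · exact Or.inr (D.isUnit_of_minimal hT hab hb)

theorem exists_associated_poly [DecidableEq I] {T : Finset I} (hT : D.Covers T) {b : IntValuedPoly}
    (hirr : Irreducible b) (hb : b ∣ D.quot T) (h₀ : ¬ D.ratPoly D.i₀ ∣ (b : ℚ[X])) :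
    ∃ i, Associated b (D.poly i) := by
  obtain ⟨V, -, hbV⟩ := D.exists_associated_prod hT hb h₀
  have hV : V.Nonempty := by
    rw [Finset.nonempty_iff_ne_empty]
    rintro rfl
    exact hirr.not_isUnit (hbV.symm.isUnit (by simp [prod]))
  obtain ⟨i, hi⟩ := hV
  refine ⟨i, ?_⟩
  have h1 : D.prod V = D.poly i * D.prod (V.erase i) := (Finset.mul_prod_erase V _ hi).symm
  rcases (hbV.irreducible hirr).isUnit_or_isUnit h1 with h2 | h2
  · exact absurd (h2.map IntValuedPoly.subtype) (D.prime_ratPoly i).not_isUnit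
  · rw [h1] at hbV
    exact hbV.trans (associated_mul_unit_left _ _ h2)

variable [Fintype I]

theorem covers_univ : D.Covers Finset.univ := fun z =>
  (D.exists_dvd z).imp fun i hi => ⟨Finset.mem_univ i, hi⟩

variable [DecidableEq I]

/-- The factorization of `p⁻¹ ∏ F i` attached to a minimal covering set `T`: one factor collects
the denominator `p` and the `F i` with `i ∈ T`, the remaining `F i` stand alone. -/
noncomputable def factorization (T : Finset I) : Multiset IntValuedPoly :=
  D.quot T ::ₘ Tᶜ.val.map D.poly

theorem card_factorization (T : Finset I) :
    Multiset.card (D.factorization T) = Tᶜ.card + 1 := by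
  simp [factorization]

theorem isFactorization {T : Finset I} (hT : Minimal D.Covers T) :
    IsFactorization (D.quot Finset.univ) (D.factorization T) := by
  constructor
  · intro a ha
    rcases Multiset.mem_cons.1 ha with rfl | ha
    · exact D.irreducible_quot hT
    · obtain ⟨i, hi, rfl⟩ := Multiset.mem_map.1 ha
      refine D.irreducible_poly fun h => ?_
      exact Finset.mem_compl.1 hi (h ▸ D.i₀_mem hT.prop)
  · rw [factorization, Multiset.prod_cons, ← D.quot_mul_prod_sdiff (Finset.subset_univ T) hT.prop
      D.covers_univ]
    rfl

theorem eq_of_essentiallySame {T U : Finset I} (hT : D.Covers T) (hU : D.Covers U)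
    (h : EssentiallySame (D.factorization T) (D.factorization U)) : T = U := by
  obtain ⟨b, hb, hab⟩ := Multiset.exists_mem_of_rel_of_mem h (Multiset.mem_cons_self _ _)
  have hdvd : ∀ i, i ∈ T ↔ D.ratPoly i ∣ (b : ℚ[X]) := fun i => by
    rw [← D.ratPoly_dvd_quot_iff hT]
    exact (hab.map IntValuedPoly.subtype).dvd_iff_dvd_right
  rcases Multiset.mem_cons.1 hb with rfl | hb
  · ext i
    rw [hdvd, D.ratPoly_dvd_quot_iff hU]
  · obtain ⟨i, hi, rfl⟩ := Multiset.mem_map.1 hb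
    have h₀ := (hdvd D.i₀).1 (D.i₀_mem hT)
    rw [coe_poly, ratPoly_dvd_iff] at h₀
    exact absurd (D.i₀_mem hU) (h₀ ▸ Finset.mem_compl.1 hi)

/-- Every factorization of `p⁻¹ ∏ F i` comes from a minimal covering set. -/
theorem exists_essentiallySame {t : Multiset IntValuedPoly}
    (ht : IsFactorization (D.quot Finset.univ) t) :
    ∃ T, Minimal D.Covers T ∧ EssentiallySame t (D.factorization T) := by
  have hU := D.covers_univ
  have hmul : ∀ a b : IntValuedPoly, a * b ∣ D.quot Finset.univ → ∀ i,
      D.ratPoly i ∣ (a : ℚ[X]) → ¬ D.ratPoly i ∣ (b : ℚ[X]) := fun a b hab i ha hb =>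
    D.not_mul_dvd_prod (T := Finset.univ) ha hb
      ((map_dvd IntValuedPoly.subtype hab).trans (D.associated_coe_quot hU).dvd)
  -- Exactly one factor `a` is divisible by `F i₀`.
  obtain ⟨a, hat, ha⟩ : ∃ a ∈ t, D.ratPoly D.i₀ ∣ IntValuedPoly.subtype a := by
    refine (D.prime_ratPoly D.i₀).exists_mem_multiset_map_dvd ?_
    rw [← map_multiset_prod, ht.2]
    exact (D.ratPoly_dvd_quot_iff hU).2 (Finset.mem_univ _)
  obtain ⟨t', rfl⟩ := Multiset.exists_cons_of_mem hat
  have hprod : a * t'.prod = D.quot Finset.univ := by rw [← ht.2, Multiset.prod_cons]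
  have ht' : ∀ b ∈ t', ∃ i, Associated b (D.poly i) := fun b hb => by
    have hab : a * b ∣ D.quot Finset.univ :=
      hprod ▸ mul_dvd_mul_left a (Multiset.dvd_prod hb)
    exact D.exists_associated_poly hU (ht.1 b (Multiset.mem_cons_of_mem hb))
      ((dvd_mul_left b a).trans hab) (hmul a b hab _ ha)
  obtain ⟨s, hs⟩ := Multiset.exists_rel_associated_map D.poly t' ht'
  have has : Associated (a * (s.map D.poly).prod) (D.quot Finset.univ) := by
    rw [← hprod]
    exact hs.associated_prod.symm.mul_left a
  -- The indices are distinct since the product of the `F i` is squarefree.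
  have hnd : s.Nodup := by
    rw [Multiset.nodup_iff_ne_cons_cons]
    rintro i r rfl
    refine hmul (D.poly i) (D.poly i) (dvd_trans ?_ has.dvd) i dvd_rfl dvd_rfl
    simp only [Multiset.map_cons, Multiset.prod_cons, ← mul_assoc]
    exact (dvd_mul_left _ a).trans (by rw [← mul_assoc]; exact dvd_mul_right _ _)
  obtain ⟨V, rfl⟩ : ∃ V : Finset I, V.val = s := ⟨⟨s, hnd⟩, rfl⟩
  obtain ⟨-, hc, haV⟩ := D.associated_quot_sdiff hU (V := V) has
  rw [← Finset.compl_eq_univ_sdiff] at hc haV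
  refine ⟨Vᶜ, ⟨hc, fun W hW hWV => ?_⟩, ?_⟩
  · have h1 := D.quot_mul_prod_sdiff hWV hW hc
    have hirr := haV.irreducible (ht.1 a hat)
    rcases hirr.isUnit_or_isUnit h1.symm with h2 | h2
    · exact absurd h2 (D.not_isUnit_quot hW)
    · exact Finset.sdiff_eq_empty_iff_subset.1 (D.eq_empty_of_isUnit_prod h2)
  · rw [factorization, compl_compl]
    exact Multiset.Rel.cons haV hs

end PrimeCoveringFamily

/-! ### Construction of covering families with prescribed residues -/

section Construction

/-- The polynomial `∏_{r ∈ S} (X - e r) + c`, residues being represented in `{0, …, p - 1}`. -/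
noncomputable def shiftedProd {p : ℕ} (e c : ℤ) (S : Finset (ZMod p)) : ℤ[X] :=
  ∏ r ∈ S, (X - C (e * (r.val : ℤ))) + C c

variable {p : ℕ} {e c : ℤ} {S : Finset (ZMod p)}

theorem eval_shiftedProd (z : ℤ) :
    (shiftedProd e c S).eval z = ∏ r ∈ S, (z - e * (r.val : ℤ)) + c := by
  simp [shiftedProd, eval_prod]

theorem degree_lt_degree_prod_X_sub_C (hS : S.Nonempty) :
    (C c : ℤ[X]).degree < (∏ r ∈ S, (X - C (e * (r.val : ℤ)))).degree := by
  refine degree_C_le.trans_lt ?_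
  rw [← natDegree_pos_iff_degree_pos, natDegree_finsetProd_X_sub_C_eq_card]
  exact hS.card_pos

theorem monic_shiftedProd (hS : S.Nonempty) : (shiftedProd e c S).Monic :=
  (monic_prod_X_sub_C _ _).add_of_left (degree_lt_degree_prod_X_sub_C hS)

theorem natDegree_shiftedProd (hS : S.Nonempty) : (shiftedProd e c S).natDegree = S.card := by
  rw [shiftedProd, natDegree_add_eq_left_of_degree_lt (degree_lt_degree_prod_X_sub_C hS),
    natDegree_finsetProd_X_sub_C_eq_card]

theorem map_shiftedProd {q : ℕ} (he : (q : ℤ) ∣ e) (hc : (q : ℤ) ∣ c) :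
    (shiftedProd e c S).map (Int.castRingHom (ZMod q)) = X ^ S.card := by
  have he' : (e : (ZMod q)[X]) = 0 := by
    rw [← C_eq_intCast, (ZMod.intCast_zmod_eq_zero_iff_dvd e q).2 he, C_0]
  have hc' : (c : (ZMod q)[X]) = 0 := by
    rw [← C_eq_intCast, (ZMod.intCast_zmod_eq_zero_iff_dvd c q).2 hc, C_0]
  simp [shiftedProd, Polynomial.map_prod, he', hc']

theorem not_dvd_eval_one_shiftedProd {q : ℕ} (hq : q.Prime) (he : (q : ℤ) ∣ e)
    (hc : (q : ℤ) ∣ c) : ¬ (q : ℤ) ∣ (shiftedProd e c S).eval 1 := by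
  have := Fact.mk hq
  rw [← ZMod.intCast_zmod_eq_zero_iff_dvd]
  have h := eval_intCast_map (Int.castRingHom (ZMod q)) (shiftedProd e c S) 1
  rw [map_shiftedProd he hc] at h
  simp only [Int.cast_one, eval_pow, eval_X, one_pow, eq_intCast] at h
  rw [← h]
  exact one_ne_zero

/-- Eisenstein's criterion at `2`. -/
theorem irreducible_shiftedProd (hS : S.Nonempty) (he : (4 : ℤ) ∣ e) (hc : (2 : ℤ) ∣ c)
    (hc' : ¬ (4 : ℤ) ∣ c) : Irreducible ((shiftedProd e c S).map (Int.castRingHom ℚ)) := by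
  have hm := monic_shiftedProd (e := e) (c := c) hS
  rw [← IsPrimitive.Int.irreducible_iff_irreducible_map_cast hm.isPrimitive]
  have hE : (shiftedProd e c S).IsEisensteinAt (Ideal.span {(2 : ℤ)}) := by
    constructor
    · rw [hm.leadingCoeff, Ideal.mem_span_singleton]
      decide
    · intro k hk
      rw [natDegree_shiftedProd hS] at hk
      have h := congrArg (fun f => f.coeff k)
        (map_shiftedProd (q := 2) (S := S) ((by decide : (2 : ℤ) ∣ 4).trans he) hc)
      simp only [coeff_map, coeff_X_pow, hk.ne, if_false, eq_intCast] at h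
      exact Ideal.mem_span_singleton.2 ((ZMod.intCast_zmod_eq_zero_iff_dvd _ 2).1 h)
    · rw [Ideal.span_singleton_pow, Ideal.mem_span_singleton, coeff_zero_eq_eval_zero,
        eval_shiftedProd]
      obtain ⟨r, hr⟩ := hS
      intro h
      refine hc' ((dvd_add_right ?_).1 h)
      exact dvd_trans (by simpa using he.mul_right _) (Finset.dvd_prod_of_mem _ hr)
  refine hE.irreducible ?_ hm.isPrimitive ?_
  · rw [Ideal.span_singleton_prime two_ne_zero]
    exact Int.prime_two
  · rw [natDegree_shiftedProd hS]
    exact hS.card_pos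

variable [Fact p.Prime]

theorem intCast_eq_one_of_dvd_sub_one (he : (p : ℤ) ∣ e - 1) : (e : ZMod p) = 1 := by
  have h := (ZMod.intCast_zmod_eq_zero_iff_dvd _ p).2 he
  push_cast at h
  exact sub_eq_zero.1 h

theorem dvd_eval_shiftedProd_iff (he : (p : ℤ) ∣ e - 1) (hc : (p : ℤ) ∣ c) (z : ℤ) :
    (p : ℤ) ∣ (shiftedProd e c S).eval z ↔ (z : ZMod p) ∈ S := by
  have he' := intCast_eq_one_of_dvd_sub_one he
  have hc' := (ZMod.intCast_zmod_eq_zero_iff_dvd c p).2 hc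
  rw [← ZMod.intCast_zmod_eq_zero_iff_dvd, eval_shiftedProd]
  push_cast
  simp [he', hc', Finset.prod_eq_zero_iff, sub_eq_zero]

/-- At `e r + p` the product `∏_{r ∈ S} (X - e r)` has `p`-adic valuation exactly `1`. -/
theorem not_sq_dvd_eval_shiftedProd (he : (p : ℤ) ∣ e - 1) (hc : (p : ℤ) ^ 2 ∣ c) {r : ZMod p}
    (hr : r ∈ S) : ¬ (p : ℤ) ^ 2 ∣ (shiftedProd e c S).eval (e * (r.val : ℤ) + p) := by
  have hp : (p : ℤ) ≠ 0 := by exact_mod_cast (Fact.out : p.Prime).ne_zero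
  rw [eval_shiftedProd, dvd_add_left hc, ← Finset.mul_prod_erase S _ hr, add_sub_cancel_left, sq,
    mul_dvd_mul_iff_left hp, (Nat.prime_iff_prime_int.1 Fact.out).dvd_finsetProd_iff]
  rintro ⟨s, hs, hd⟩
  have h := (ZMod.intCast_zmod_eq_zero_iff_dvd _ p).2 hd
  push_cast at h
  simp [intCast_eq_one_of_dvd_sub_one he] at h
  exact Finset.ne_of_mem_erase hs (sub_eq_zero.1 h).symm

/-- A product of monic integer polynomials cannot vanish identically modulo a prime exceeding its
degree. -/
theorem exists_forall_not_dvd_eval {I : Type*} [Fintype I] {F : I → ℤ[X]}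
    (hF : ∀ i, (F i).Monic) {q : ℕ} (hq : q.Prime) (hdeg : ∑ i, (F i).natDegree < q) :
    ∃ z : ℤ, ∀ i, ¬ (q : ℤ) ∣ (F i).eval z := by
  have := Fact.mk hq
  by_contra! h
  set G : (ZMod q)[X] := ∏ i, (F i).map (Int.castRingHom (ZMod q)) with hG
  have hGm : G.Monic := monic_prod_of_monic _ _ fun i _ => (hF i).map _
  refine hGm.ne_zero (eq_zero_of_natDegree_lt_card_of_eval_eq_zero' G Finset.univ ?_ ?_)
  · intro x _
    obtain ⟨i, hi⟩ := h x.val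
    rw [hG, eval_prod]
    refine Finset.prod_eq_zero (Finset.mem_univ i) ?_
    have h2 := eval_intCast_map (Int.castRingHom (ZMod q)) (F i) x.val
    rw [eq_intCast, Int.cast_id, (ZMod.intCast_zmod_eq_zero_iff_dvd _ q).2 hi] at h2
    simpa using h2
  · rw [Finset.card_univ, ZMod.card, hG, natDegree_prod_of_monic _ _ fun i _ => (hF i).map _]
    simpa [(hF _).natDegree_map] using hdeg

/-- Up to the bound `B`, all primes other than `p` divide `2 M`, where `M` is odd; and `e` is a
simultaneous solution of `e ≡ 1` modulo `p` and `e ≡ 0` modulo `4 M`. -/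
theorem exists_modulus (hp2 : p ≠ 2) (B : ℕ) : ∃ M e : ℤ, Odd M ∧
    (∀ q : ℕ, q.Prime → q ≠ p → q ≤ B → (q : ℤ) ∣ 2 * M) ∧ 4 * M ∣ e ∧ (p : ℤ) ∣ e - 1 := by
  have hp : p.Prime := Fact.out
  set s := (((Finset.range (B + 1)).filter Nat.Prime).erase 2).erase p with hs
  have hsp : ∀ q ∈ s, q.Prime ∧ q ≠ 2 ∧ q ≠ p := fun q hq => by
    simp only [hs, Finset.mem_erase, Finset.mem_filter] at hq
    exact ⟨hq.2.2.2, hq.2.1, hq.1⟩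
  have hcop : Nat.Coprime p (4 * ∏ q ∈ s, q) := by
    refine Nat.Coprime.mul_right ?_ (Nat.Coprime.prod_right fun q hq => ?_)
    · exact Nat.Coprime.pow_right 2 ((Nat.coprime_primes hp Nat.prime_two).2 hp2)
    · exact (Nat.coprime_primes hp (hsp q hq).1).2 (hsp q hq).2.2.symm
  obtain ⟨e, he1, he0⟩ := Nat.chineseRemainder hcop 1 0
  refine ⟨((∏ q ∈ s, q : ℕ) : ℤ), e, ?_, ?_, ?_, ?_⟩
  · rw [Int.odd_coe_nat, ← Nat.not_even_iff_odd, even_iff_two_dvd,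
      Nat.prime_two.prime.dvd_finsetProd_iff]
    rintro ⟨q, hq, hd⟩
    exact (hsp q hq).2.1 ((Nat.prime_dvd_prime_iff_eq Nat.prime_two (hsp q hq).1).1 hd).symm
  · intro q hq hqp hqB
    by_cases h2 : q = 2
    · subst h2
      exact dvd_mul_right _ _
    · refine Dvd.dvd.mul_left (Int.natCast_dvd_natCast.2 (Finset.dvd_prod_of_mem _ ?_)) _
      simp only [hs, Finset.mem_erase, Finset.mem_filter, Finset.mem_range]
      exact ⟨hqp, h2, by omega, hq⟩
  · exact_mod_cast Nat.modEq_zero_iff_dvd.1 he0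
  · exact (Nat.modEq_iff_dvd.1 he1.symm)

/-- Any cover of `ZMod p` by nonempty sets `S i`, some residue lying in a single one of them, is
realized by irreducible polynomials `F i` such that `p ∣ F i z` exactly when `z mod p ∈ S i`. -/
theorem exists_primeCoveringFamily (hp2 : p ≠ 2) {I : Type*} [Fintype I]
    (S : I → Finset (ZMod p)) (hS : ∀ i, (S i).Nonempty) (hcov : ∀ r, ∃ i, r ∈ S i) (i₀ : I)
    (r₀ : ZMod p) (hr₀ : ∀ i, r₀ ∈ S i ↔ i = i₀) :
    ∃ D : PrimeCoveringFamily p I,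
      ∀ i (z : ℤ), (p : ℤ) ∣ (D.F i).eval z ↔ (z : ZMod p) ∈ S i := by
  have hp : p.Prime := Fact.out
  obtain ⟨M, e, hM, hMq, hMe, hpe⟩ := exists_modulus (p := p) hp2 (∑ i, (S i).card)
  -- The odd factors `2 k + 1`, with `k` depending injectively on `i`, make the `F i` distinct.
  set c : I → ℤ := fun i => (p : ℤ) ^ 2 * (2 * M) * (2 * (Fintype.equivFin I i : ℕ) + 1) with hc
  have hcp : ∀ i, (p : ℤ) ^ 2 ∣ c i := fun i => by
    rw [hc]; exact (dvd_mul_right _ _).mul_right _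
  have hcp1 : ∀ i, (p : ℤ) ∣ c i := fun i => (dvd_pow_self _ two_ne_zero).trans (hcp i)
  have hcM : ∀ i, 2 * M ∣ c i := fun i => by
    rw [hc]; exact (dvd_mul_left _ _).mul_right _
  have hpodd : Odd (p : ℤ) := by
    rw [Int.odd_coe_nat]; exact hp.odd_of_ne_two hp2
  have hc4 : ∀ i, ¬ (4 : ℤ) ∣ c i := fun i h => by
    have ho : Odd ((p : ℤ) ^ 2 * M * (2 * (Fintype.equivFin I i : ℕ) + 1)) :=
      (hpodd.pow.mul hM).mul ⟨_, rfl⟩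
    have he : c i = 2 * ((p : ℤ) ^ 2 * M * (2 * (Fintype.equivFin I i : ℕ) + 1)) := by
      rw [hc]; ring
    obtain ⟨k, hk⟩ := ho
    rw [he, hk] at h
    omega
  have hdvd : ∀ i (z : ℤ), (p : ℤ) ∣ (shiftedProd e (c i) (S i)).eval z ↔ (z : ZMod p) ∈ S i :=
    fun i z => dvd_eval_shiftedProd_iff hpe (hcp1 i) z
  have hz₀ : ((e * (r₀.val : ℤ) + p : ℤ) : ZMod p) = r₀ := by
    simp [intCast_eq_one_of_dvd_sub_one hpe]
  refine ⟨{
    F := fun i => shiftedProd e (c i) (S i)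
    prime := hp
    monic := fun i => monic_shiftedProd (hS i)
    irreducible := fun i => irreducible_shiftedProd (hS i) ((dvd_mul_right _ _).trans hMe)
      ((dvd_mul_right _ _).trans (hcM i)) (hc4 i)
    injective := ?_
    exists_dvd := fun z => (hcov z).imp fun i hi => (hdvd i z).2 hi
    i₀ := i₀
    z₀ := e * (r₀.val : ℤ) + p
    not_sq_dvd := not_sq_dvd_eval_shiftedProd hpe (hcp i₀) ((hr₀ i₀).2 rfl)
    not_dvd := ?_
    exists_not_dvd := ?_ }, hdvd⟩
  · intro i j hij
    replace hij : shiftedProd e (c i) (S i) = shiftedProd e (c j) (S j) := hij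
    have hSij : S i = S j := by
      ext r
      have h1 := hdvd i r.val
      have h2 := hdvd j r.val
      rw [hij] at h1
      simpa using h1.symm.trans h2
    simp only [shiftedProd, hSij, add_right_inj, C_inj, hc] at hij
    have hne : (p : ℤ) ^ 2 * (2 * M) ≠ 0 := fun h => hc4 i (by simp [hc, h])
    have hk := mul_left_cancel₀ hne hij
    refine (Fintype.equivFin I).injective (Fin.ext ?_)
    omega
  · intro i hi
    rw [hdvd, hz₀, hr₀]
    exact hi
  · intro q hq hqp
    by_cases hqB : q ≤ ∑ i, (S i).card
    · have hq2 := hMq q hq hqp hqB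
      refine ⟨1, fun i => not_dvd_eval_one_shiftedProd hq ?_ (hq2.trans (hcM i))⟩
      exact hq2.trans ((Dvd.intro_left 2 (by ring)).trans hMe)
    · refine exists_forall_not_dvd_eval (fun i => monic_shiftedProd (hS i)) hq ?_
      simp only [natDegree_shiftedProd (hS _)]
      omega

end Construction

/-! ### A cover whose minimal subcovers are the complements of the classes -/

section MinimalCovers

variable {n : ℕ} (m : Fin n → ℕ)

/-- The residues assigned to an index. The residue `ρ (some (some (a, b)))`, where `a` and `b`
lie in different classes, is shared by `some a` and `some b` only; `ρ none` is shared by all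
`some a`, which makes their sets nonempty; `none` receives all residues except those of pairs, in
particular `ρ (some none)`, which no other index has. -/
def residues {R : Type*} [Fintype R] [DecidableEq R]
    (ρ : Option (Option ((Σ k, Fin (m k)) × (Σ k, Fin (m k)))) ↪ R) :
    Option (Σ k, Fin (m k)) → Finset R
  | none => Finset.univ.filter fun r => ∀ a b, a.1 ≠ b.1 → r ≠ ρ (some (some (a, b)))
  | some a => Finset.univ.filter fun r => r = ρ none ∨
      ∃ b, b.1 ≠ a.1 ∧ (r = ρ (some (some (a, b))) ∨ r = ρ (some (some (b, a))))

variable {m} {R : Type*} [Fintype R] [DecidableEq R]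
  (ρ : Option (Option ((Σ k, Fin (m k)) × (Σ k, Fin (m k)))) ↪ R)

theorem residues_nonempty (i : Option (Σ k, Fin (m k))) : (residues m ρ i).Nonempty := by
  refine ⟨ρ none, ?_⟩
  cases i <;> simp [residues]

theorem mem_residues_iff_eq_none (i : Option (Σ k, Fin (m k))) :
    ρ (some none) ∈ residues m ρ i ↔ i = none := by
  cases i <;> simp [residues]

theorem mem_residues_pair_iff {a b : Σ k, Fin (m k)} (hab : a.1 ≠ b.1)
    (i : Option (Σ k, Fin (m k))) :
    ρ (some (some (a, b))) ∈ residues m ρ i ↔ i = some a ∨ i = some b := by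
  cases i with
  | none =>
    simp only [residues, Finset.mem_filter, Finset.mem_univ, true_and, reduceCtorEq, or_self,
      iff_false]
    exact fun h => h a b hab rfl
  | some d =>
    simp only [residues, Finset.mem_filter, Finset.mem_univ, true_and, Option.some.injEq,
      EmbeddingLike.apply_eq_iff_eq, reduceCtorEq, false_or, Prod.mk.injEq]
    constructor
    · rintro ⟨x, -, ⟨rfl, -⟩ | ⟨-, rfl⟩⟩
      · exact Or.inl rfl
      · exact Or.inr rfl
    · rintro (rfl | rfl)
      · exact ⟨b, hab.symm, Or.inl ⟨rfl, rfl⟩⟩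
      · exact ⟨a, hab, Or.inr ⟨rfl, rfl⟩⟩

/-- A set of indices covers all residues iff it contains `none` and its complement lies in a
single class. -/
theorem forall_exists_mem_residues_iff (T : Finset (Option (Σ k, Fin (m k)))) :
    (∀ r, ∃ i ∈ T, r ∈ residues m ρ i) ↔
      none ∈ T ∧ ∀ a b : Σ k, Fin (m k), a.1 ≠ b.1 → some a ∈ T ∨ some b ∈ T := by
  constructor
  · intro h
    constructor
    · obtain ⟨i, hi, hr⟩ := h (ρ (some none))
      exact (mem_residues_iff_eq_none ρ i).1 hr ▸ hi
    · intro a b hab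
      obtain ⟨i, hi, hr⟩ := h (ρ (some (some (a, b))))
      exact ((mem_residues_pair_iff ρ hab i).1 hr).imp (fun e : i = some a => e ▸ hi)
        fun e : i = some b => e ▸ hi
  · rintro ⟨h₀, h⟩ r
    by_cases hr : ∃ a b : Σ k, Fin (m k), a.1 ≠ b.1 ∧ r = ρ (some (some (a, b)))
    · obtain ⟨a, b, hab, rfl⟩ := hr
      rcases h a b hab with hT | hT
      · exact ⟨_, hT, (mem_residues_pair_iff ρ hab _).2 (Or.inl rfl)⟩
      · exact ⟨_, hT, (mem_residues_pair_iff ρ hab _).2 (Or.inr rfl)⟩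
    · push Not at hr
      exact ⟨none, h₀, by simpa [residues] using hr⟩

theorem exists_mem_residues [NeZero n] (r : R) : ∃ i, r ∈ residues m ρ i := by
  obtain ⟨i, -, hi⟩ := (forall_exists_mem_residues_iff ρ Finset.univ).2 (by simp) r
  exact ⟨i, hi⟩

variable (m) in
/-- All indices except the class `h`. -/
def classCompl (h : Fin n) : Finset (Option (Σ k, Fin (m k))) :=
  Finset.univ.filter fun i => ∀ a, i = some a → a.1 ≠ h

theorem none_mem_classCompl (h : Fin n) : none ∈ classCompl m h := by
  simp [classCompl]

theorem some_mem_classCompl {h : Fin n} {a : Σ k, Fin (m k)} :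
    some a ∈ classCompl m h ↔ a.1 ≠ h := by
  simp [classCompl]

theorem card_compl_classCompl (h : Fin n) : (classCompl m h)ᶜ.card = m h := by
  have : (classCompl m h)ᶜ =
      (Finset.univ : Finset (Fin (m h))).image fun j => some (⟨h, j⟩ : Σ k, Fin (m k)) := by
    ext i
    rcases i with _ | ⟨k, j⟩
    · simp [none_mem_classCompl]
    · simp only [Finset.mem_compl, some_mem_classCompl, not_not, Finset.mem_image,
        Finset.mem_univ, true_and, Option.some.injEq]
      constructor
      · rintro rfl
        exact ⟨j, rfl⟩
      · rintro ⟨j', hj⟩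
        exact (congrArg Sigma.fst hj).symm
  rw [this, Finset.card_image_of_injective, Finset.card_univ, Fintype.card_fin]
  intro j j' h
  simpa using h

theorem classCompl_injective (hm : ∀ k, 1 ≤ m k) : Function.Injective (classCompl m) := by
  intro h h' e
  by_contra hne
  have h1 : some (⟨h, ⟨0, hm h⟩⟩ : Σ k, Fin (m k)) ∈ classCompl m h' :=
    some_mem_classCompl.2 hne
  rw [← e, some_mem_classCompl] at h1
  exact h1 rfl

theorem minimal_cover_iff [NeZero n] (hm : ∀ k, 1 ≤ m k)
    (T : Finset (Option (Σ k, Fin (m k)))) :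
    Minimal (fun U : Finset (Option (Σ k, Fin (m k))) =>
      none ∈ U ∧ ∀ a b : Σ k, Fin (m k), a.1 ≠ b.1 → some a ∈ U ∨ some b ∈ U) T ↔
      ∃ h, T = classCompl m h := by
  have hcov : ∀ h, none ∈ classCompl m h ∧ ∀ a b : Σ k, Fin (m k), a.1 ≠ b.1 →
      some a ∈ classCompl m h ∨ some b ∈ classCompl m h := fun h => by
    refine ⟨none_mem_classCompl h, fun a b hab => ?_⟩
    simp only [some_mem_classCompl]
    by_contra! h'
    exact hab (h'.1.trans h'.2.symm)
  constructor
  · intro hT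
    obtain ⟨h, hh⟩ : ∃ h, classCompl m h ≤ T := by
      by_cases hall : ∀ a : Σ k, Fin (m k), some a ∈ T
      · refine ⟨0, fun i _ => ?_⟩
        cases i with
        | none => exact hT.prop.1
        | some a => exact hall a
      · push Not at hall
        obtain ⟨a, ha⟩ := hall
        refine ⟨a.1, fun i hi => ?_⟩
        cases i with
        | none => exact hT.prop.1
        | some b => exact (hT.prop.2 b a (some_mem_classCompl.1 hi)).resolve_right ha
    exact ⟨h, le_antisymm (hT.le_of_le (hcov h) hh) hh⟩
  · rintro ⟨h, rfl⟩
    refine ⟨hcov h, fun U hU hUh i hi => ?_⟩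
    cases i with
    | none => exact hU.1
    | some a =>
      refine (hU.2 a ⟨h, ⟨0, hm h⟩⟩ (some_mem_classCompl.1 hi)).resolve_right fun h0 => ?_
      exact some_mem_classCompl.1 (hUh h0) rfl

end MinimalCovers

theorem theorem9 (n : ℕ) (m : Fin n → ℕ) (hm_pos : ∀ i, 1 ≤ m i) (hm_mono : Monotone m) :
    ∃ (H : IntValuedPoly) (s : Fin n → Multiset IntValuedPoly),
      (∀ i, IsFactorization H (s i)) ∧
      (∀ i, Multiset.card (s i) = m i + 1) ∧
      (∀ i j, i ≠ j → ¬ EssentiallySame (s i) (s j)) ∧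
      (∀ t : Multiset IntValuedPoly, IsFactorization H t → ∃ i, EssentiallySame t (s i)) := by
  rcases Nat.eq_zero_or_pos n with rfl | hn
  · -- The polynomial `0` has no factorization into irreducibles.
    refine ⟨0, Fin.elim0, fun i => i.elim0, fun i => i.elim0, fun i => i.elim0, fun t ht => ?_⟩
    exact absurd rfl (ht.1 0 (Multiset.prod_eq_zero_iff.1 ht.2)).ne_zero
  have : NeZero n := ⟨hn.ne'⟩
  obtain ⟨p, hpc, hp⟩ := Nat.exists_infinite_primes
    (Fintype.card (Option (Option ((Σ k, Fin (m k)) × (Σ k, Fin (m k))))) + 3)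
  have := Fact.mk hp
  obtain ⟨ρ⟩ : Nonempty
      (Option (Option ((Σ k, Fin (m k)) × (Σ k, Fin (m k)))) ↪ ZMod p) :=
    Function.Embedding.nonempty_of_card_le (by rw [ZMod.card]; omega)
  obtain ⟨D, hD⟩ := exists_primeCoveringFamily (by omega) (residues m ρ) (residues_nonempty ρ)
    (exists_mem_residues ρ) none (ρ (some none)) (mem_residues_iff_eq_none ρ)
  have hcov : D.Covers = fun U => none ∈ U ∧
      ∀ a b : Σ k, Fin (m k), a.1 ≠ b.1 → some a ∈ U ∨ some b ∈ U := by
    funext U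
    rw [← forall_exists_mem_residues_iff ρ, PrimeCoveringFamily.Covers]
    simp only [hD]
    exact propext ((ZMod.intCast_surjective (n := p)).forall
      (p := fun r => ∃ i ∈ U, r ∈ residues m ρ i)).symm
  have hmin : ∀ T, Minimal D.Covers T ↔ ∃ h, T = classCompl m h := by
    rw [hcov]
    exact minimal_cover_iff hm_pos
  have hmin' : ∀ h, Minimal D.Covers (classCompl m h) := fun h => (hmin _).2 ⟨h, rfl⟩
  refine ⟨D.quot Finset.univ, fun h => D.factorization (classCompl m h),
    fun h => D.isFactorization (hmin' h), fun h => ?_, fun i j hij hs => ?_, fun t ht => ?_⟩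
  · rw [D.card_factorization, card_compl_classCompl]
  · exact hij (classCompl_injective hm_pos
      (D.eq_of_essentiallySame (hmin' i).prop (hmin' j).prop hs))
  · obtain ⟨T, hT, ht⟩ := D.exists_essentiallySame ht
    obtain ⟨h, rfl⟩ := (hmin T).1 hT
    exact ⟨h, ht⟩
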